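/- \textbf{Setting.} Let $\mathcal M$ be a (nonempty) connected, complete, finite-dimensional smooth Riemannian manifold with distance $\mathrm{dist}$. For real weights $w_j$ and points $p_j\in\mathcal M$ ($j$ in a finite index set) let $\mathrm{mean}(w,p)\subset\mathcal M$ be the set of all minimizers $v$ of $\sum_j w_j\,\mathrm{dist}(v,p_j)^2$. Let $s\in\mathbb N$, $N'\in\mathbb N^s$, $R\in\mathbb N$, and let $N=2^RN'$; a signal is a family $u=(u_n)_{0\le n<N}\in\mathcal M^N$. For $0\le r\le R$ put $\tilde u_{n,r}=u_{2^{R-r}n}$, $0\le n<2^rN'$. Let $a=(a_i)_{i\in\mathbb Z^s}$ be a finitely supported real mask with $\sum_k a_{n-2k}=1$ for all $n\in\mathbb Z^s$ and $a_{2i}=\delta_{i0}$ for all $i\in\mathbb Z^s$ (a dyadic interpolatory scheme reproducing constants). The scheme on the bounded grids is given, for $1\le r\le R$ and $0\le n<2^rN'$, by real weights $w^{r,n}_k$, $0\le k<2^{r-1}N'$, with $\sum_k w^{r,n}_k=1$, such that $w^{r,n}_k=a_{n-2k}$ for all $k$ whenever $\{k\in\mathbb Z^s: a_{n-2k}\ne0\}$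 is contained in the grid of level $r-1$; at the remaining positions $n$ near the boundary the weights are arbitrary (periodization, reflection, polynomial boundary rules, etc.). Let $\mathrm S\tilde u_{n,r-1}=\mathrm{mean}(w^{r,n},\tilde u_{\cdot,r-1})$, a set of predictions. The detail $d_{n,r}(u)$ is the set of all tangent vectors of smallest Riemannian norm among the vectors $2^{-sr/2}\exp_{\hat u}^{-1}(\tilde u_{n,r})\in T_{\hat u}\mathcal M$, $\hat u\in\mathrm S\tilde u_{n,r-1}$, where $\exp_x^{-1}(y)$ runs through the initial velocities of all minimizing geodesics $[0,1]\to\mathcal M$ from $x$ to $y$; $d_{n,r}(u)\neq0$ means that it does not contain a zero vector. For $\lambda_1,\lambda_2\ge0$ let $$\mathcal W^0_\lambda(u)=\lambda_1\,\#\{(n,r): 1\le r\le R,\ 0\le n<2^rN',\ d_{n,r}(u)\ne0\}+\lambda_2\,\#\{(n,i): 0\le n-e_i,\ n<N',\ 1\le i\le s,\ \tilde u_{n-e_i,0}\ne\tilde u_{n,0}\}.$$ Let $K\in\mathbb N^{s'}$ be a multiindex, $f\in\mathcal M^K$ data and $p>0$. An imaging operator $\mathcal A$ is given by a real matrix $(A_{ij})_{0\le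 i<K,\,0\le j<N}$ with $\sum_jA_{ij}>0$ for every $i$: $\mathcal A(u)_i$ is an element of $\mathrm{mean}(A_{i,\cdot},u)$ which, if the mean is not unique, is chosen closest to $f_i$. Write $\mathrm{dist}(\mathcal A(u),f)^p=\sum_i\mathrm{dist}(\mathcal A(u)_i,f_i)^p$, and let $\mathrm{diam}$ of a signal be the diameter of the set of its values. \textbf{Theorem.} (1) Assume that there is a constant $C>0$ such that $$\mathrm{diam}(u)\le C\,\mathrm{diam}(\mathcal A(u))\qquad\text{for every }u\in\mathcal M^N$$ (for some admissible choice of $\mathcal A(u)$ if there are several). Then the functional $$u\mapsto \mathrm{dist}(\mathcal A(u),f)^p+\mathcal W^0_\lambda(u)$$ has a minimizer in $\mathcal M^N$. (2) In particular, for every $f\in\mathcal M^N$ the functional $u\mapsto\sum_n\mathrm{dist}(u_n,f_n)^p+\mathcal W^0_\lambda(u)$ (that is, $\mathcal A$ is the identity) has a minimizer. (3) If $\mathcal M$ is compact, the functional in (1) has a minimizer for every imaging operator $\mathcal A$ as above and every $f\in\mathcal M^K$, without the diameter condition. -/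

import Mathlib

open scoped Manifold ContDiff Bundle
open Bundle

noncomputable section

/-- The grid `{0, …, N₁ - 1} × … × {0, …, N_s - 1}` of multiindices `0 ≤ n < N`. -/
abbrev Grid {s : ℕ} (N : Fin s → ℕ) : Type := ∀ i, Fin (N i)

/-- The multiindices `0 ≤ n < 2 ^ r * N'` of level `r`. -/
abbrev LevelGrid {s : ℕ} (N' : Fin s → ℕ) (r : ℕ) : Type := Grid fun i => 2 ^ r * N' i

/-- A multiindex of a grid, read in `ℤ ^ s`. -/
def toInt {s : ℕ} {N : Fin s → ℕ} (n : Grid N) : Fin s → ℤ := fun i => ((n i : ℕ) : ℤ)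

/-- The set of intrinsic means of the points `p j` with (possibly negative) weights `w j`: all
minimizers `v` of `∑ j, w j * dist v (p j) ^ 2`. -/
def intrinsicMean {M ι : Type*} [MetricSpace M] [Fintype ι] (w : ι → ℝ) (p : ι → M) : Set M :=
  {v | ∀ v' : M, ∑ j, w j * dist v (p j) ^ 2 ≤ ∑ j, w j * dist v' (p j) ^ 2}

/-- The mask of a dyadic interpolatory subdivision scheme in `s` variables: finitely supported,
the rule for every position reproduces constants, and the coarse grid values are kept. -/
structure IsInterpolatoryMask {s : ℕ} (a : (Fin s → ℤ) →₀ ℝ) : Prop where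
  reproduces_constants : ∀ n : Fin s → ℤ, ∑ᶠ k : Fin s → ℤ, a (n - 2 • k) = 1
  interpolatory : ∀ i : Fin s → ℤ, a (2 • i) = if i = 0 then 1 else 0

/-- The coefficients of the scheme with mask `a` on the bounded grids of the levels `r`, together
with its boundary treatment. `weight r n k` is the coefficient of the `k`-th data point of level
`r` in the prediction at position `n` of level `r + 1`. Where the stencil of the mask fits into
the grid, it is `a (n - 2 k)`; elsewhere (periodization, reflection, polynomial fitting, …) the
rule has to reproduce constants. -/
structure SubdivisionRule {s : ℕ} (a : (Fin s → ℤ) →₀ ℝ) (N' : Fin s → ℕ) where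
  weight : ∀ r : ℕ, LevelGrid N' (r + 1) → LevelGrid N' r → ℝ
  sum_weight : ∀ (r : ℕ) (n : LevelGrid N' (r + 1)), ∑ k, weight r n k = 1
  weight_eq_mask : ∀ (r : ℕ) (n : LevelGrid N' (r + 1)),
    (∀ k : Fin s → ℤ, a (toInt n - 2 • k) ≠ 0 → ∃ m : LevelGrid N' r, toInt m = k) →
      ∀ k : LevelGrid N' r, weight r n k = a (toInt n - 2 • toInt k)

/-- The samples `u (2 ^ (R - r) * n)` of level `r ≤ R` of a signal `u` of level `R`. -/
def sample {M : Type*} {s : ℕ} {N' : Fin s → ℕ} {R : ℕ} (u : LevelGrid N' R → M)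
    (r : ℕ) (hr : r ≤ R) (n : LevelGrid N' r) : M :=
  u fun i => ⟨2 ^ (R - r) * (n i : ℕ), by
    have h : 2 ^ R * N' i = 2 ^ (R - r) * (2 ^ r * N' i) := by
      rw [← mul_assoc, ← pow_add, Nat.sub_add_cancel hr]
    change _ < 2 ^ R * N' i
    rw [h]
    exact Nat.mul_lt_mul_of_pos_left (n i).isLt (by positivity)⟩

/-- The prediction set at position `n` of level `r + 1`: all means of the level `r` samples with
the weights of the subdivision rule. -/
def prediction {M : Type*} [MetricSpace M] {s : ℕ} {a : (Fin s → ℤ) →₀ ℝ} {N' : Fin s → ℕ}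
    (S : SubdivisionRule a N') {R : ℕ} (u : LevelGrid N' R → M) (r : ℕ) (hr : r < R)
    (n : LevelGrid N' (r + 1)) : Set M :=
  intrinsicMean (S.weight r n) (sample u r hr.le)

section Manifold

variable (E : Type*) [NormedAddCommGroup E] [NormedSpace ℝ E]
  {M : Type*} [MetricSpace M] [ChartedSpace E M]

/-- `γ`, restricted to `[0, 1]`, is a minimizing geodesic from `x` to `y`: a smooth curve that is
parametrized proportionally to arc length and realizes the distance between any two of its
points. -/
structure IsMinimizingGeodesic (γ : ℝ → M) (x y : M) : Prop where
  smooth : ContMDiffOn 𝓘(ℝ, ℝ) 𝓘(ℝ, E) ∞ γ (Set.Icc 0 1)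
  source : γ 0 = x
  target : γ 1 = y
  dist_eq : ∀ t₁ ∈ Set.Icc (0 : ℝ) 1, ∀ t₂ ∈ Set.Icc (0 : ℝ) 1,
    dist (γ t₁) (γ t₂) = |t₁ - t₂| * dist x y

/-- The inverse of the Riemannian exponential map, `y ⊖ x = exp_x⁻¹ y`, as a set: the initial
velocities in `T_x M` of the minimizing geodesics from `x` to `y`. -/
def riemannianLog (x y : M) : Set (TangentSpace 𝓘(ℝ, E) x) :=
  {v | ∃ γ : ℝ → M, IsMinimizingGeodesic E γ x y ∧
    (v : E) = mfderivWithin 𝓘(ℝ, ℝ) 𝓘(ℝ, E) γ (Set.Icc 0 1) 0 (1 : ℝ)}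

variable {s : ℕ} {a : (Fin s → ℤ) →₀ ℝ} {N' : Fin s → ℕ}

/-- The tangent vectors `2 ^ (-s (r + 1) / 2) (ũ ⊖ û)`, sitting in `û`, where `ũ` is the sample at
position `n` of level `r + 1` and `û` runs through all predictions of it. -/
def detailCandidates (S : SubdivisionRule a N') {R : ℕ} (u : LevelGrid N' R → M) (r : ℕ)
    (hr : r < R) (n : LevelGrid N' (r + 1)) : Set (TangentBundle 𝓘(ℝ, E) M) :=
  {ξ | ξ.proj ∈ prediction S u r hr n ∧
    ∃ v ∈ riemannianLog E ξ.proj (sample u (r + 1) hr n),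
      ξ.snd = (2 : ℝ) ^ (-((s : ℝ) * ((r : ℝ) + 1) / 2)) • v}

variable [RiemannianBundle (fun x : M => TangentSpace 𝓘(ℝ, E) x)]

/-- The detail of `u` at position `n` of level `r + 1`: the candidates of smallest Riemannian
norm. -/
def details (S : SubdivisionRule a N') {R : ℕ} (u : LevelGrid N' R → M) (r : ℕ)
    (hr : r < R) (n : LevelGrid N' (r + 1)) : Set (TangentBundle 𝓘(ℝ, E) M) :=
  {ξ | ξ ∈ detailCandidates E S u r hr n ∧
    ∀ η ∈ detailCandidates E S u r hr n, ‖ξ.snd‖ ≤ ‖η.snd‖}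

/-- The positions `(r + 1, n)` (levels `1, …, R`) of the nonzero details of `u`. -/
def nonzeroDetails (S : SubdivisionRule a N') {R : ℕ} (u : LevelGrid N' R → M) :
    Set (Σ r : Fin R, LevelGrid N' ((r : ℕ) + 1)) :=
  {x | ∀ ξ ∈ details E S u x.1 x.1.isLt x.2, ξ.snd ≠ 0}

/-- The pairs `(n, i)` such that `n` and `n - e_i` lie in the coarsest grid and carry unequal
samples of `u`. -/
def unequalNeighbours {R : ℕ} (u : LevelGrid N' R → M) : Set (LevelGrid N' 0 × Fin s) :=
  {x | ∃ m : LevelGrid N' 0, toInt m = toInt x.1 - Pi.single x.2 1 ∧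
    sample u 0 (Nat.zero_le R) m ≠ sample u 0 (Nat.zero_le R) x.1}

/-- The `ℓ⁰`-type wavelet regularizer. -/
def waveletL0 (S : SubdivisionRule a N') {R : ℕ} (lam₁ lam₂ : ℝ) (u : LevelGrid N' R → M) : ℝ :=
  lam₁ * (nonzeroDetails E S u).ncard + lam₂ * (unequalNeighbours u).ncard

end Manifold

section Imaging

variable {M : Type*} [MetricSpace M] {ι κ : Type*} [Fintype ι] [Fintype κ]

/-- The values of the imaging operator with matrix `A` at `u`. The `i`-th component is an intrinsic
mean of `u` with the weights of the `i`-th row; where this mean is not unique, one that is closest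
to the datum `f i` is taken. -/
def imaging (A : Matrix κ ι ℝ) (f : κ → M) (u : ι → M) : Set (κ → M) :=
  {v | ∀ i, v i ∈ intrinsicMean (A i) u ∧
    ∀ y ∈ intrinsicMean (A i) u, dist (v i) (f i) ≤ dist y (f i)}

/-- `∑ i, dist (𝒜(u) i, f i) ^ p`, where `dist (𝒜(u) i, f i)` is the distance of `f i` from the set
of means (which is one point if the mean is unique). -/
def dataTerm (A : Matrix κ ι ℝ) (f : κ → M) (p : ℝ) (u : ι → M) : ℝ :=
  ∑ i, Metric.infDist (f i) (intrinsicMean (A i) u) ^ p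

end Imaging

end

/-! Direct method: the functional is lower semicontinuous and, in (1) and (2), its sublevel sets are
bounded. A finite-dimensional complete `M` is proper (Hopf–Rinow), so bounded closed sets of signals
are compact.

The weights of a mean may be negative, but their sum is positive; the weighted sum of squares then
grows quadratically, which gives existence of means and a bound on them that is uniform in the data.
The graph of the mean is closed. Hence the data term is lower semicontinuous, and "the sample is one
of its predictions" is a closed condition. A detail vanishes exactly under this condition
(`mem_nonzeroDetails_iff`), so both summands of the regularizer count open conditions. The diameter
hypothesis bounds `u`: a small data term bounds 𝒜(u), hence the diameter of `u`, and a mean of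
clustered points lies near them. In (3) compactness replaces boundedness. -/

/-! ### Hopf–Rinow: properness of the manifold -/

/-- Approximate convexity of the distance: if `dist x y < a + b`, some point lies within `a` of `x`
and within `b` of `y`. -/
def HasIntermediatePoints (M : Type*) [MetricSpace M] : Prop :=
  ∀ (x y : M) (a b : ℝ), 0 ≤ a → 0 ≤ b → dist x y < a + b → ∃ z, dist x z ≤ a ∧ dist z y ≤ b

/-- The theorem of Hopf, Rinow and Cohn-Vossen. -/
theorem HasIntermediatePoints.properSpace {M : Type*} [MetricSpace M] [CompleteSpace M]
    [LocallyCompactSpace M] (h : HasIntermediatePoints M) : ProperSpace M := by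
  refine ⟨fun x r₀ => ?_⟩
  by_contra hr₀
  set S : Set ℝ := {r | IsCompact (Metric.closedBall x r)} with hS
  have hdown : ∀ r ∈ S, ∀ r' ≤ r, r' ∈ S := fun r hr r' hle =>
    IsCompact.of_isClosed_subset hr Metric.isClosed_closedBall
      (Metric.closedBall_subset_closedBall hle)
  have h0 : (0 : ℝ) ∈ S := by simp [hS]
  have hbdd : BddAbove S := ⟨r₀, fun r hr => le_of_not_ge fun hle => hr₀ (hdown r hr r₀ hle)⟩
  have hs0 : 0 ≤ sSup S := le_csSup hbdd h0
  -- The supremum of the compact radii is attained: an `ε / 2`-net of a slightly smaller ball is an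
  -- `ε`-net.
  have hcpt : IsCompact (Metric.closedBall x (sSup S)) := by
    refine isCompact_iff_totallyBounded_isComplete.2
      ⟨Metric.totallyBounded_iff.2 fun ε hε => ?_, Metric.isClosed_closedBall.isComplete⟩
    obtain ⟨r, hrS, hr⟩ := exists_lt_of_lt_csSup ⟨0, h0⟩ (show sSup S - ε / 2 < sSup S by linarith)
    have hmS : max r 0 ∈ S := by
      rcases max_choice r 0 with h | h <;> rw [h] <;> assumption
    obtain ⟨t, htf, ht⟩ := Metric.totallyBounded_iff.1 (IsCompact.totallyBounded hmS) (ε / 2)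
      (by positivity)
    refine ⟨t, htf, fun y hy => ?_⟩
    rw [Metric.mem_closedBall, dist_comm] at hy
    obtain ⟨z, hxz, hzy⟩ := h x y (max r 0) (ε / 2) (le_max_right _ _) (by positivity)
      (by linarith [le_max_left r 0])
    have hz := ht (show z ∈ Metric.closedBall x (max r 0) by rwa [Metric.mem_closedBall, dist_comm])
    simp only [Set.mem_iUnion, Metric.mem_ball, exists_prop] at hz ⊢
    obtain ⟨c, hct, hc⟩ := hz
    refine ⟨c, hct, ?_⟩
    rw [dist_comm z y] at hzy
    linarith [dist_triangle y z c]
  -- A compact thickening of the maximal ball contains a larger ball, which contradicts maximality.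
  obtain ⟨δ, hδ, hδc⟩ := hcpt.exists_isCompact_cthickening
  have hmem : sSup S + δ / 2 ∈ S := by
    refine IsCompact.of_isClosed_subset hδc Metric.isClosed_closedBall fun y hy => ?_
    rw [Metric.mem_closedBall, dist_comm] at hy
    obtain ⟨z, hxz, hzy⟩ := h x y (sSup S) δ hs0 hδ.le (by linarith)
    rw [dist_comm] at hxz hzy
    exact Metric.mem_cthickening_of_dist_le y z δ _ (Metric.mem_closedBall.2 hxz) hzy
  linarith [le_csSup hbdd hmem]

/-- Take a path from `x` to `y` of length below `a + b` and cut it where its distance from `x`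
equals `a`; the remaining arc is shorter than `b`. -/
theorem hasIntermediatePoints_of_isRiemannianManifold
    (E : Type*) [NormedAddCommGroup E] [NormedSpace ℝ E]
    (M : Type*) [MetricSpace M] [ChartedSpace E M] [IsManifold 𝓘(ℝ, E) 1 M]
    [RiemannianBundle (fun x : M => TangentSpace 𝓘(ℝ, E) x)]
    [IsRiemannianManifold 𝓘(ℝ, E) M] : HasIntermediatePoints M := by
  intro x y a b ha hb hxy
  rcases le_or_gt (dist x y) a with hle | hlt
  · exact ⟨y, hle, by simpa using hb⟩
  have hlen : Manifold.riemannianEDist 𝓘(ℝ, E) x y < ENNReal.ofReal (a + b) := by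
    rw [← IsRiemannianManifold.out (I := 𝓘(ℝ, E)) x y, edist_dist]
    exact (ENNReal.ofReal_lt_ofReal_iff (dist_nonneg.trans_lt hxy)).2 hxy
  obtain ⟨γ, h0, h1, hγ, hγlen, -, -⟩ :=
    Manifold.exists_lt_locally_constant_of_riemannianEDist_lt hlen zero_lt_one
  obtain ⟨t, ht, hta⟩ : a ∈ (fun t => dist x (γ t)) '' Set.Icc 0 1 :=
    intermediate_value_Icc zero_le_one
      (Continuous.continuousOn (continuous_const.dist hγ.continuous))
      ⟨by simpa [h0] using ha, by simpa [h1] using hlt.le⟩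
  refine ⟨γ t, hta.le, ?_⟩
  have hl : edist x (γ t) ≤ Manifold.pathELength 𝓘(ℝ, E) γ 0 t := by
    rw [IsRiemannianManifold.out (I := 𝓘(ℝ, E)) x]
    exact Manifold.riemannianEDist_le_pathELength hγ.contMDiffOn h0 rfl ht.1
  have hr : edist (γ t) y ≤ Manifold.pathELength 𝓘(ℝ, E) γ t 1 := by
    rw [IsRiemannianManifold.out (I := 𝓘(ℝ, E)) (γ t)]
    exact Manifold.riemannianEDist_le_pathELength hγ.contMDiffOn rfl h1 ht.2
  have hsum := (add_le_add hl hr).trans_lt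
    ((Manifold.pathELength_add ht.1 ht.2).trans_lt hγlen)
  rw [edist_dist, edist_dist, ← ENNReal.ofReal_add dist_nonneg dist_nonneg,
    ENNReal.ofReal_lt_ofReal_iff (dist_nonneg.trans_lt hxy)] at hsum
  simp only at hta
  linarith

/-! ### Vanishing initial velocities -/

/-- A minimizing geodesic with vanishing initial velocity is constant. -/
theorem eq_of_zero_mem_riemannianLog {E : Type*} [NormedAddCommGroup E] [NormedSpace ℝ E]
    {M : Type*} [MetricSpace M] [ChartedSpace E M] [IsManifold 𝓘(ℝ, E) ∞ M]
    [RiemannianBundle (fun x : M => TangentSpace 𝓘(ℝ, E) x)]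
    [IsContMDiffRiemannianBundle 𝓘(ℝ, E) ∞ E (fun x : M => TangentSpace 𝓘(ℝ, E) x)]
    [IsRiemannianManifold 𝓘(ℝ, E) M] {x y : M}
    (h : (0 : TangentSpace 𝓘(ℝ, E) x) ∈ riemannianLog E x y) : x = y := by
  obtain ⟨γ, hγ, hv⟩ := h
  obtain ⟨hsm, hγ0, hγ1, hd⟩ := hγ
  subst hγ0
  have : IsContinuousRiemannianBundle E (fun x : M => TangentSpace 𝓘(ℝ, E) x) := by
    obtain ⟨g, hg, hgi⟩ := IsContMDiffRiemannianBundle.exists_contMDiff (IB := 𝓘(ℝ, E)) (n := ∞)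
      (F := E) (E := fun x : M => TangentSpace 𝓘(ℝ, E) x)
    exact ⟨g, hg.continuous, hgi⟩
  have : IsManifold 𝓘(ℝ, E) 1 M := inferInstance
  have hm : mfderivWithin 𝓘(ℝ, ℝ) 𝓘(ℝ, E) γ (Set.Icc 0 1) 0 = 0 := by
    ext
    exact hv.symm
  have hder := ((hsm 0 (by simp)).mdifferentiableWithinAt (by simp)).hasMFDerivWithinAt
  rw [hm] at hder
  have hF : HasFDerivWithinAt (fun t => extChartAt 𝓘(ℝ, E) (γ 0) (γ t)) (0 : ℝ →L[ℝ] E)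
      (Set.Icc 0 1) 0 := by
    exact hder.2.mono (fun t ht => ⟨ht, t, rfl⟩)
  -- Near `γ 0` the distance is at most `C` times the chart distance, which is `o(t)` along `γ`; yet
  -- it equals `t * dist (γ 0) y`.
  obtain ⟨C, hC, hCd⟩ := eventually_riemannianEDist_le_edist_extChartAt 𝓘(ℝ, E) (γ 0)
  have hCt := (hsm.continuousOn 0 (by simp)).eventually hCd
  by_contra hne
  have hpos : 0 < dist (γ 0) y := dist_pos.2 hne
  have hC' : (0 : ℝ) < C := hC
  have hlo := hF.isLittleO.def (show 0 < dist (γ 0) y / (2 * C) by positivity)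
  have hex : ∃ᶠ t in nhdsWithin (0 : ℝ) (Set.Icc 0 1), 0 < t := by
    have : nhdsWithin (0 : ℝ) (Set.Ioc 0 1) ≤ nhdsWithin (0 : ℝ) (Set.Icc 0 1) :=
      nhdsWithin_mono _ Set.Ioc_subset_Icc_self
    refine Filter.Frequently.filter_mono ?_ this
    rw [nhdsWithin_Ioc_eq_nhdsGT zero_lt_one]
    exact Filter.Eventually.frequently self_mem_nhdsWithin
  have hmem : ∀ᶠ t in nhdsWithin (0 : ℝ) (Set.Icc 0 1), t ∈ Set.Icc (0 : ℝ) 1 :=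
    self_mem_nhdsWithin
  obtain ⟨t, ht, h1, h2, h3⟩ := (hex.and_eventually (hCt.and (hlo.and hmem))).exists
  rw [← IsRiemannianManifold.out (I := 𝓘(ℝ, E)), edist_dist, edist_dist,
    ← ENNReal.ofReal_coe_nnreal, ← ENNReal.ofReal_mul hC'.le,
    ENNReal.ofReal_le_ofReal_iff (by positivity), hd 0 (by simp) t h3,
    dist_comm (extChartAt _ _ _), dist_eq_norm] at h1
  simp only [zero_sub, abs_neg, sub_zero, zero_apply, Real.norm_eq_abs,
    abs_of_pos ht] at h1 h2
  have h4 : t * dist (γ 0) y ≤ C * (dist (γ 0) y / (2 * C) * t) :=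
    h1.trans (mul_le_mul_of_nonneg_left h2 hC'.le)
  have h5 : C * (dist (γ 0) y / (2 * C) * t) = t * dist (γ 0) y / 2 := by
    field_simp
  have := mul_pos ht hpos
  linarith

/-! ### Means with signed weights and the data term -/

section Means

variable {M ι : Type*} [MetricSpace M] [Fintype ι]

theorem continuous_weightedSqDist (w : ι → ℝ) :
    Continuous fun q : (ι → M) × M => ∑ j, w j * dist q.2 (q.1 j) ^ 2 := by
  fun_prop

theorem isClosed_setOf_mem_intrinsicMean (w : ι → ℝ) :
    IsClosed {q : (ι → M) × M | q.2 ∈ intrinsicMean w q.1} := by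
  have : {q : (ι → M) × M | q.2 ∈ intrinsicMean w q.1} = ⋂ v' : M, {q : (ι → M) × M |
      ∑ j, w j * dist q.2 (q.1 j) ^ 2 ≤ ∑ j, w j * dist v' (q.1 j) ^ 2} := by
    ext q
    simp [intrinsicMean]
  rw [this]
  exact isClosed_iInter fun v' => isClosed_le (continuous_weightedSqDist w) (by fun_prop)

theorem isClosed_intrinsicMean (w : ι → ℝ) (p : ι → M) : IsClosed (intrinsicMean w p) :=
  (isClosed_setOf_mem_intrinsicMean w).preimage (Continuous.prodMk_right p)

/-- Points with a small weighted sum of squared distances are close to the data. -/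
theorem exists_dist_le_of_weightedSqDist_le {w : ι → ℝ} (hw : 0 < ∑ j, w j) (D : ℝ) :
    ∃ B : ℝ, ∀ (p : ι → M) (x v : M), (∀ j, dist x (p j) ≤ D) →
      ∑ j, w j * dist v (p j) ^ 2 ≤ ∑ j, w j * dist x (p j) ^ 2 → dist v x ≤ B := by
  set σ := ∑ j, w j with hσ
  set T := ∑ j, |w j| with hT
  have hT0 : 0 ≤ T := Finset.sum_nonneg fun j _ => abs_nonneg _
  -- Comparing `dist v (p j)` with `d = dist v x` gives `σ d² ≤ 2T|D| d + 2TD²`. The summand 1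
  -- forces `d ≥ 1`, so that the constant term is absorbed into the linear one.
  refine ⟨2 * T * |D| / σ + 1 + 2 * T * D ^ 2 / σ, fun p x v hD hle => ?_⟩
  by_contra! hlt
  set d := dist v x with hd
  have hd0 : 0 ≤ d := dist_nonneg
  have hterm : ∀ j, w j * d ^ 2 - |w j| * (2 * d * |D| + D ^ 2) ≤ w j * dist v (p j) ^ 2 := by
    intro j
    have h1 : |dist v (p j) - d| ≤ D := by
      rw [abs_le]
      constructor <;> linarith [dist_triangle v x (p j), dist_triangle v (p j) x, hD j,
        dist_comm x (p j)]
    have hD0 : 0 ≤ D := (abs_nonneg _).trans h1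
    have h2 : |dist v (p j) ^ 2 - d ^ 2| ≤ 2 * d * |D| + D ^ 2 := by
      rw [abs_of_nonneg hD0]
      obtain ⟨h3, h4⟩ := abs_le.1 h1
      have h5 : 0 ≤ dist v (p j) := dist_nonneg
      rw [abs_le]
      constructor <;> nlinarith
    have h6 : |w j * (dist v (p j) ^ 2 - d ^ 2)| ≤ |w j| * (2 * d * |D| + D ^ 2) := by
      rw [abs_mul]
      exact mul_le_mul_of_nonneg_left h2 (abs_nonneg _)
    linarith [(abs_le.1 h6).1]
  have hup : ∀ j, w j * dist x (p j) ^ 2 ≤ |w j| * D ^ 2 := fun j =>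
    mul_le_mul (le_abs_self _) (pow_le_pow_left₀ dist_nonneg (hD j) 2) (by positivity)
      (abs_nonneg _)
  have hsum := (Finset.sum_le_sum fun j (_ : j ∈ Finset.univ) => hterm j).trans
    (hle.trans (Finset.sum_le_sum fun j (_ : j ∈ Finset.univ) => hup j))
  rw [Finset.sum_sub_distrib, ← Finset.sum_mul, ← Finset.sum_mul, ← Finset.sum_mul, ← hσ, ← hT]
    at hsum
  have hB : 2 * T * |D| + σ + 2 * T * D ^ 2 < σ * d := by
    have := mul_lt_mul_of_pos_left hlt hw
    field_simp at this
    linarith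
  have h1 : 0 ≤ 2 * T * |D| / σ := by positivity
  have h2 : 0 ≤ 2 * T * D ^ 2 / σ := by positivity
  have hd1 : 1 ≤ d := by linarith
  have h3 := mul_le_mul_of_nonneg_right hB.le hd0
  have h4 : 2 * T * D ^ 2 ≤ 2 * T * D ^ 2 * d := le_mul_of_one_le_right (by positivity) hd1
  nlinarith [mul_pos hw (zero_lt_one.trans_le hd1)]

/-- All competitors at least as good as `x` lie in one compact ball. Nonemptiness also keeps
`Metric.infDist` from taking its default value 0 on the empty set. -/
theorem intrinsicMean_nonempty [ProperSpace M] [Nonempty M] {w : ι → ℝ} (hw : 0 < ∑ j, w j)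
    (p : ι → M) : (intrinsicMean w p).Nonempty := by
  obtain ⟨x⟩ := ‹Nonempty M›
  obtain ⟨D, hD⟩ := (Set.finite_range fun j => dist x (p j)).bddAbove
  obtain ⟨B, hB⟩ := exists_dist_le_of_weightedSqDist_le (M := M) hw D
  have hxD : ∀ j, dist x (p j) ≤ D := fun j => hD ⟨j, rfl⟩
  have hcont : Continuous fun v : M => ∑ j, w j * dist v (p j) ^ 2 := by fun_prop
  have hxB : x ∈ Metric.closedBall x B := hB p x x hxD le_rfl
  obtain ⟨v, -, hv⟩ := (isCompact_closedBall x B).exists_isMinOn ⟨x, hxB⟩ hcont.continuousOn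
  refine ⟨v, fun v' => ?_⟩
  by_cases hle : ∑ j, w j * dist v' (p j) ^ 2 ≤ ∑ j, w j * dist x (p j) ^ 2
  · exact hv (show v' ∈ Metric.closedBall x B from hB p x v' hxD hle)
  · exact (hv hxB).trans (le_of_not_ge hle)

/-- The distance of a point from the set of means depends lower semicontinuously on the data. -/
theorem lowerSemicontinuous_infDist_intrinsicMean [ProperSpace M] {w : ι → ℝ}
    (hw : 0 < ∑ j, w j) (y : M) :
    LowerSemicontinuous fun u : ι → M => Metric.infDist y (intrinsicMean w u) := by
  rw [lowerSemicontinuous_iff_isClosed_preimage]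
  intro c
  have : Nonempty M := ⟨y⟩
  have hcpt : CompactSpace (Metric.closedBall y c) :=
    isCompact_iff_compactSpace.1 (isCompact_closedBall y c)
  have hcl : IsClosed {q : (ι → M) × Metric.closedBall y c | (q.2 : M) ∈ intrinsicMean w q.1} :=
    (isClosed_setOf_mem_intrinsicMean w).preimage
      (f := fun q : (ι → M) × Metric.closedBall y c => (q.1, (q.2 : M))) (by fun_prop)
  -- The sublevel set is the projection, along a compact ball, of the closed graph of the mean.
  convert! isClosedMap_fst_of_compactSpace _ hcl using 1
  ext u
  simp only [Set.mem_preimage, Set.mem_Iic, Set.mem_image, Set.mem_ofPred_eq, Prod.exists,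
    exists_and_right, exists_eq_right, Subtype.exists, exists_prop, Metric.mem_closedBall]
  constructor
  · intro h
    obtain ⟨v, hv, hvd⟩ := (isClosed_intrinsicMean w u).exists_infDist_eq_dist
      (intrinsicMean_nonempty hw u) y
    exact ⟨v, by rwa [dist_comm, ← hvd], hv⟩
  · rintro ⟨v, hvd, hv⟩
    exact (Metric.infDist_le_dist_of_mem hv).trans (by rwa [dist_comm])

theorem lowerSemicontinuous_dataTerm [ProperSpace M] {κ : Type*} [Fintype κ] {A : Matrix κ ι ℝ}
    (hA : ∀ i, 0 < ∑ j, A i j) (f : κ → M) {p : ℝ} (hp : 0 < p) :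
    LowerSemicontinuous (dataTerm A f p) := by
  refine lowerSemicontinuous_sum fun i _ => ?_
  -- Truncation at 0 makes the power monotone on all of `ℝ` and changes nothing at distances.
  have hg : Continuous fun x : ℝ => max x 0 ^ p :=
    (continuous_id.max continuous_const).rpow_const fun _ => Or.inr hp.le
  have hm : Monotone fun x : ℝ => max x 0 ^ p := fun x y hxy =>
    Real.rpow_le_rpow (le_max_right _ _) (max_le_max_right _ hxy) hp.le
  have := hg.comp_lowerSemicontinuous
    (lowerSemicontinuous_infDist_intrinsicMean (hA i) (f i)) hm
  simpa [Function.comp_def, max_eq_left Metric.infDist_nonneg] using this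

theorem dist_eq_infDist_of_mem_imaging {κ : Type*} [Fintype κ] {A : Matrix κ ι ℝ} {f : κ → M}
    {u : ι → M} {v : κ → M} (hv : v ∈ imaging A f u) (i : κ) :
    dist (v i) (f i) = Metric.infDist (f i) (intrinsicMean (A i) u) := by
  refine le_antisymm ((Metric.le_infDist ⟨v i, (hv i).1⟩).2 fun y hy => ?_) ?_
  · rw [dist_comm (f i)]
    exact (hv i).2 y hy
  · rw [dist_comm]
    exact Metric.infDist_le_dist_of_mem (hv i).1

/-- Signals of small diameter and small data term stay in a bounded set. -/
theorem exists_dist_le_of_dataTerm_le {κ : Type*} [Fintype κ] [Nonempty κ]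
    {A : Matrix κ ι ℝ} (hA : ∀ i, 0 < ∑ j, A i j) (f : κ → M) {p : ℝ} (hp : 0 < p)
    (hdiam : ∃ C : ℝ, 0 < C ∧ ∀ u : ι → M, ∃ v ∈ imaging A f u,
        Metric.diam (Set.range u) ≤ C * Metric.diam (Set.range v)) (c : ℝ) (x : M) :
    ∃ B : ℝ, ∀ u : ι → M, dataTerm A f p u ≤ c → ∀ j, dist (u j) x ≤ B := by
  obtain ⟨C, hC, hCd⟩ := hdiam
  obtain ⟨D, hD⟩ := (Set.finite_range fun i => dist (f i) x).bddAbove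
  obtain ⟨i₀⟩ := ‹Nonempty κ›
  set b := |c| ^ p⁻¹
  -- The values of 𝒜(u) lie within `b + D` of `x`, so this radius bounds the diameter of `u`; one
  -- row then ties every `u j` to the mean `v i₀`.
  obtain ⟨B, hB⟩ := exists_dist_le_of_weightedSqDist_le (M := M) (hA i₀) (C * (2 * (b + D)))
  refine ⟨B + (b + D), fun u hu j => ?_⟩
  obtain ⟨v, hv, hvd⟩ := hCd u
  have hvf : ∀ i, dist (v i) x ≤ b + D := by
    intro i
    have h1 : Metric.infDist (f i) (intrinsicMean (A i) u) ^ p ≤ c :=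
      (Finset.single_le_sum
        (f := fun i => Metric.infDist (f i) (intrinsicMean (A i) u) ^ p)
        (fun i _ => Real.rpow_nonneg Metric.infDist_nonneg p) (Finset.mem_univ i)).trans hu
    have h2 : dist (v i) (f i) ≤ b := by
      rw [dist_eq_infDist_of_mem_imaging hv i]
      exact (Real.le_rpow_inv_iff_of_pos Metric.infDist_nonneg (abs_nonneg c) hp).2
        (h1.trans (le_abs_self c))
    have h3 : dist (f i) x ≤ D := hD ⟨i, rfl⟩
    linarith [dist_triangle (v i) (f i) x]
  have hdv : Metric.diam (Set.range v) ≤ 2 * (b + D) := by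
    refine Metric.diam_le_of_forall_dist_le
      (by linarith [hvf i₀, dist_nonneg (x := v i₀) (y := x)]) ?_
    rintro _ ⟨i, rfl⟩ _ ⟨k, rfl⟩
    linarith [dist_triangle_right (v i) (v k) x, hvf i, hvf k]
  have hdu : ∀ k l, dist (u k) (u l) ≤ C * (2 * (b + D)) := fun k l =>
    (Metric.dist_le_diam_of_mem (Set.finite_range u).isBounded ⟨k, rfl⟩ ⟨l, rfl⟩).trans
      (hvd.trans (mul_le_mul_of_nonneg_left hdv hC.le))
  have hmean := hB u (u j) (v i₀) (hdu j) ((hv i₀).1 (u j))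
  linarith [dist_triangle_left (u j) x (v i₀), hvf i₀]

end Means

/-! ### The direct method and counting functionals -/

section Minimizers

/-- A lower semicontinuous function on a finite power of a proper space has a minimizer if its
sublevel sets are bounded. -/
theorem exists_isMinOn_of_lowerSemicontinuous {ι M : Type*} [Finite ι] [MetricSpace M]
    [ProperSpace M] (F : (ι → M) → ℝ) (hF : LowerSemicontinuous F) (x : M)
    (hb : ∃ B : ℝ, ∀ u, F u ≤ F (fun _ => x) → ∀ j, dist (u j) x ≤ B) :
    ∃ u, IsMinOn F Set.univ u := by
  obtain ⟨B, hB⟩ := hb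
  have hcpt : IsCompact (Set.univ.pi fun _ : ι => Metric.closedBall x B) :=
    isCompact_univ_pi fun _ => isCompact_closedBall x B
  have hmem : ∀ u, F u ≤ F (fun _ => x) → u ∈ Set.univ.pi fun _ : ι => Metric.closedBall x B :=
    fun u hu j _ => hB u hu j
  obtain ⟨u, -, hu⟩ := LowerSemicontinuousOn.exists_isMinOn ⟨_, hmem _ le_rfl⟩ hcpt
    (hF.lowerSemicontinuousOn _)
  refine ⟨u, fun v _ => ?_⟩
  by_cases hle : F v ≤ F fun _ => x
  · exact hu (hmem v hle)
  · exact (hu (hmem _ le_rfl)).trans (le_of_not_ge hle)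

/-- The number of open conditions that hold is lower semicontinuous. -/
theorem lowerSemicontinuous_ncard {X β : Type*} [TopologicalSpace X] [Finite β] {s : X → Set β}
    (hs : ∀ b, IsOpen {x | b ∈ s x}) : LowerSemicontinuous fun x => ((s x).ncard : ℝ) := by
  intro x c hc
  have : ∀ᶠ x' in nhds x, ∀ b, b ∈ s x → b ∈ s x' :=
    Filter.eventually_all.2 fun b => by
      by_cases hb : b ∈ s x
      · filter_upwards [(hs b).mem_nhds hb] with x' hx' _ using hx'
      · exact Filter.Eventually.of_forall fun _ h => absurd h hb
  filter_upwards [this] with x' hx'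
  exact hc.trans_le (Nat.cast_le.2 (Set.ncard_le_ncard hx' (Set.toFinite _)))

end Minimizers

theorem continuous_sample {M : Type*} [TopologicalSpace M] {s : ℕ} {N' : Fin s → ℕ} {R : ℕ}
    (r : ℕ) (hr : r ≤ R) : Continuous fun u : LevelGrid N' R → M => sample u r hr :=
  continuous_pi fun _ => continuous_apply _

/-! ### The wavelet regularizer -/

section Wavelet

variable {E : Type*} [NormedAddCommGroup E] [NormedSpace ℝ E]
  {M : Type*} [MetricSpace M] [ChartedSpace E M] [IsManifold 𝓘(ℝ, E) ∞ M]
  [RiemannianBundle (fun x : M => TangentSpace 𝓘(ℝ, E) x)]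
  [IsContMDiffRiemannianBundle 𝓘(ℝ, E) ∞ E (fun x : M => TangentSpace 𝓘(ℝ, E) x)]
  [IsRiemannianManifold 𝓘(ℝ, E) M]
  {s : ℕ} {a : (Fin s → ℤ) →₀ ℝ} {N' : Fin s → ℕ} {R : ℕ}

theorem zero_mem_riemannianLog_self (E : Type*) [NormedAddCommGroup E] [NormedSpace ℝ E]
    {M : Type*} [MetricSpace M] [ChartedSpace E M] (x : M) :
    (0 : TangentSpace 𝓘(ℝ, E) x) ∈ riemannianLog E x x := by
  refine ⟨fun _ => x, ⟨contMDiffOn_const, rfl, rfl, by simp⟩, ?_⟩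
  rw [mfderivWithin_const]
  rfl

/-- A detail vanishes if and only if the sample is one of its predictions. -/
theorem mem_nonzeroDetails_iff (S : SubdivisionRule a N') (u : LevelGrid N' R → M)
    (x : Σ r : Fin R, LevelGrid N' ((r : ℕ) + 1)) :
    x ∈ nonzeroDetails E S u ↔
      sample u (x.1 + 1) x.1.isLt x.2 ∉ prediction S u x.1 x.1.isLt x.2 := by
  rw [← not_iff_not, not_not]
  simp only [nonzeroDetails, Set.mem_ofPred_eq, not_forall, not_not]
  constructor
  · rintro ⟨ξ, ⟨⟨hpred, v, hv, hξv⟩, -⟩, h0⟩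
    rw [hξv, smul_eq_zero_iff_right (by positivity)] at h0
    rw [h0] at hv
    rwa [← eq_of_zero_mem_riemannianLog hv]
  · intro h
    -- The constant geodesic yields a zero candidate, automatically of least norm; no existence of
    -- other geodesics is needed.
    refine ⟨⟨sample u (x.1 + 1) x.1.isLt x.2, 0⟩, ⟨⟨h, 0, zero_mem_riemannianLog_self E _, ?_⟩,
      fun η _ => ?_⟩, rfl⟩
    · rw [smul_zero]
    · rw [norm_zero]
      exact norm_nonneg _

theorem lowerSemicontinuous_waveletL0 (S : SubdivisionRule a N') {lam₁ lam₂ : ℝ}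
    (hlam₁ : 0 ≤ lam₁) (hlam₂ : 0 ≤ lam₂) :
    LowerSemicontinuous fun u : LevelGrid N' R → M => waveletL0 E S lam₁ lam₂ u := by
  have hmul : ∀ {c : ℝ} (_ : 0 ≤ c) {g : (LevelGrid N' R → M) → ℝ} (_ : LowerSemicontinuous g),
      LowerSemicontinuous fun u => c * g u := fun {c} hc {g} hg =>
    (continuous_const_mul c).comp_lowerSemicontinuous hg (monotone_mul_left_of_nonneg hc)
  refine LowerSemicontinuous.add (hmul hlam₁ (lowerSemicontinuous_ncard fun x => ?_))
    (hmul hlam₂ (lowerSemicontinuous_ncard fun x => ?_))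
  · simp only [mem_nonzeroDetails_iff]
    refine IsClosed.isOpen_compl (s := {u : LevelGrid N' R → M |
      sample u (x.1 + 1) x.1.isLt x.2 ∈ prediction S u x.1 x.1.isLt x.2}) (self := ?_)
    exact (isClosed_setOf_mem_intrinsicMean (S.weight x.1 x.2)).preimage
      (f := fun u : LevelGrid N' R → M =>
        (sample u x.1 x.1.isLt.le, sample u (x.1 + 1) x.1.isLt x.2))
      ((continuous_sample _ _).prodMk
        ((continuous_apply x.2).comp (continuous_sample (x.1 + 1) x.1.isLt)))
  · have : {u : LevelGrid N' R → M | x ∈ unequalNeighbours u} = ⋃ m : LevelGrid N' 0,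
        {u | toInt m = toInt x.1 - Pi.single x.2 1 ∧
          sample u 0 (Nat.zero_le R) m ≠ sample u 0 (Nat.zero_le R) x.1} := by
      ext u
      simp [unequalNeighbours]
    rw [this]
    refine isOpen_iUnion fun m => isOpen_const.and (isOpen_ne_fun ?_ ?_)
    exacts [(continuous_apply m).comp (continuous_sample 0 (Nat.zero_le R)),
      (continuous_apply x.1).comp (continuous_sample 0 (Nat.zero_le R))]

end Wavelet

theorem waveletL0_nonneg (E : Type*) [NormedAddCommGroup E] [NormedSpace ℝ E]
    {M : Type*} [MetricSpace M] [ChartedSpace E M]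
    [RiemannianBundle (fun x : M => TangentSpace 𝓘(ℝ, E) x)]
    {s : ℕ} {a : (Fin s → ℤ) →₀ ℝ} {N' : Fin s → ℕ} (S : SubdivisionRule a N') {R : ℕ}
    {lam₁ lam₂ : ℝ} (hlam₁ : 0 ≤ lam₁) (hlam₂ : 0 ≤ lam₂) (u : LevelGrid N' R → M) :
    0 ≤ waveletL0 E S lam₁ lam₂ u := by
  unfold waveletL0
  positivity

theorem waveletL0_const (E : Type*) [NormedAddCommGroup E] [NormedSpace ℝ E]
    {M : Type*} [MetricSpace M] [ChartedSpace E M] [IsManifold 𝓘(ℝ, E) ∞ M]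
    [RiemannianBundle (fun x : M => TangentSpace 𝓘(ℝ, E) x)]
    [IsContMDiffRiemannianBundle 𝓘(ℝ, E) ∞ E (fun x : M => TangentSpace 𝓘(ℝ, E) x)]
    [IsRiemannianManifold 𝓘(ℝ, E) M]
    {s : ℕ} {a : (Fin s → ℤ) →₀ ℝ} {N' : Fin s → ℕ} (S : SubdivisionRule a N') {R : ℕ}
    (lam₁ lam₂ : ℝ) (x : M) :
    waveletL0 E S lam₁ lam₂ (fun _ : LevelGrid N' R => x) = 0 := by
  have h1 : nonzeroDetails E S (fun _ : LevelGrid N' R => x) = ∅ := by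
    refine Set.eq_empty_iff_forall_notMem.2 fun y => ?_
    rw [mem_nonzeroDetails_iff, not_not]
    intro v'
    -- As the weights sum to 1, the objective is `dist v' x ^ 2`, minimal at `x`.
    simp only [sample, dist_self, ← Finset.sum_mul, S.sum_weight]
    rw [zero_pow two_ne_zero, mul_zero, one_mul]
    exact sq_nonneg _
  have h2 : unequalNeighbours (fun _ : LevelGrid N' R => x) = ∅ :=
    Set.eq_empty_iff_forall_notMem.2 fun y ⟨_, _, h⟩ => h rfl
  simp [waveletL0, h1, h2]

/-! ### Existence of minimizers -/

theorem mainTheorem3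
    {E : Type*} [NormedAddCommGroup E] [NormedSpace ℝ E] [FiniteDimensional ℝ E]
    {M : Type*} [MetricSpace M] [ChartedSpace E M] [IsManifold 𝓘(ℝ, E) ∞ M]
    [RiemannianBundle (fun x : M => TangentSpace 𝓘(ℝ, E) x)]
    [IsContMDiffRiemannianBundle 𝓘(ℝ, E) ∞ E (fun x : M => TangentSpace 𝓘(ℝ, E) x)]
    [IsRiemannianManifold 𝓘(ℝ, E) M] [CompleteSpace M] [ConnectedSpace M]
    {s : ℕ} (N' : Fin s → ℕ) (R : ℕ)
    (a : (Fin s → ℤ) →₀ ℝ) (ha : IsInterpolatoryMask a) (S : SubdivisionRule a N')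
    (lam₁ lam₂ p : ℝ) (hlam₁ : 0 ≤ lam₁) (hlam₂ : 0 ≤ lam₂) (hp : 0 < p) :
    (∀ (s' : ℕ) (K : Fin s' → ℕ) (A : Matrix (Grid K) (LevelGrid N' R) ℝ) (f : Grid K → M),
      (∀ i, 0 < ∑ j, A i j) →
      (∃ C : ℝ, 0 < C ∧ ∀ u : LevelGrid N' R → M, ∃ v ∈ imaging A f u,
        Metric.diam (Set.range u) ≤ C * Metric.diam (Set.range v)) →
      ∃ u : LevelGrid N' R → M,
        IsMinOn (fun w => dataTerm A f p w + waveletL0 E S lam₁ lam₂ w) Set.univ u) ∧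
    (∀ f : LevelGrid N' R → M, ∃ u : LevelGrid N' R → M,
      IsMinOn (fun w => (∑ n, dist (w n) (f n) ^ p) + waveletL0 E S lam₁ lam₂ w) Set.univ u) ∧
    (CompactSpace M →
      ∀ (s' : ℕ) (K : Fin s' → ℕ) (A : Matrix (Grid K) (LevelGrid N' R) ℝ) (f : Grid K → M),
      (∀ i, 0 < ∑ j, A i j) →
      ∃ u : LevelGrid N' R → M,
        IsMinOn (fun w => dataTerm A f p w + waveletL0 E S lam₁ lam₂ w) Set.univ u) := by

  have : LocallyCompactSpace M := Manifold.locallyCompact_of_finiteDimensional 𝓘(ℝ, E)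
  have : IsManifold 𝓘(ℝ, E) 1 M := inferInstance
  have : ProperSpace M := (hasIntermediatePoints_of_isRiemannianManifold E M).properSpace
  obtain ⟨x⟩ : Nonempty M := inferInstance
  have hW := lowerSemicontinuous_waveletL0 (E := E) (M := M) (R := R) S hlam₁ hlam₂
  have hW0 := fun u : LevelGrid N' R → M => waveletL0_nonneg E S hlam₁ hlam₂ u
  refine ⟨fun s' K A f hA hdiam => ?_, fun f => ?_, fun hM s' K A f hA => ?_⟩
  · rcases isEmpty_or_nonempty (Grid K) with hK | hK
    -- Without data there is no coercivity, but constants give the value 0.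
    · refine ⟨fun _ => x, fun w _ => ?_⟩
      simpa [dataTerm, waveletL0_const] using hW0 w
    · refine exists_isMinOn_of_lowerSemicontinuous _
        ((lowerSemicontinuous_dataTerm hA f hp).add hW) x ?_
      obtain ⟨B, hB⟩ := exists_dist_le_of_dataTerm_le hA f hp hdiam
        (dataTerm A f p (fun _ => x) + waveletL0 E S lam₁ lam₂ (fun _ => x)) x
      exact ⟨B, fun u hu => hB u (by linarith [hW0 u])⟩
  -- For the identity, the data term is itself continuous and bounds each `u n` directly, so (1) is
  -- not invoked.
  · have hcont : Continuous fun w : LevelGrid N' R → M => ∑ n, dist (w n) (f n) ^ p :=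
      continuous_finsetSum _ fun n _ =>
        ((continuous_apply n).dist continuous_const).rpow_const fun _ => Or.inr hp.le
    refine exists_isMinOn_of_lowerSemicontinuous _ (hcont.lowerSemicontinuous.add hW) x ?_
    obtain ⟨D, hD⟩ := (Set.finite_range fun n => dist (f n) x).bddAbove
    refine ⟨|(∑ n, dist x (f n) ^ p) + waveletL0 E S lam₁ lam₂ fun _ : LevelGrid N' R => x| ^ p⁻¹ + D,
      fun u hu n => ?_⟩
    have h1 : dist (u n) (f n) ^ p ≤ ∑ n, dist (u n) (f n) ^ p :=
      Finset.single_le_sum (f := fun n => dist (u n) (f n) ^ p)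
        (fun n _ => Real.rpow_nonneg dist_nonneg p) (Finset.mem_univ n)
    have h2 := (Real.le_rpow_inv_iff_of_pos dist_nonneg (abs_nonneg _) hp).2
      ((h1.trans (by linarith [hW0 u])).trans (hu.trans (le_abs_self _)))
    have h3 : dist (f n) x ≤ D := hD ⟨n, rfl⟩
    linarith [dist_triangle (u n) (f n) x]
  · obtain ⟨u, -, hu⟩ := LowerSemicontinuousOn.exists_isMinOn
      (s := (Set.univ : Set (LevelGrid N' R → M))) ⟨fun _ => x, trivial⟩ isCompact_univ
      (((lowerSemicontinuous_dataTerm hA f hp).add hW).lowerSemicontinuousOn _)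
    exact ⟨u, hu⟩
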